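/- **Setting.** Let $(X,Y)$ be a random pair with values in $\mathbb R^d\times\{0,1\}$ and let $(X_1,Y_1),\dots,(X_n,Y_n)$, $n\ge 1$, be i.i.d. copies of it. For a measurable $f:\mathbb R^d\to\{0,1\}$ put $$L(f)=\mathbb P\{f(X)\ne Y\},\qquad \widehat L(f)=\frac1n\sum_{i=1}^n\mathbb I\{f(X_i)\ne Y_i\},\qquad L^*=\inf_{f}L(f),$$ the infimum being over all measurable $f:\mathbb R^d\to\{0,1\}$. Let $\mathcal F_1,\mathcal F_2,\dots$ be nonempty classes of measurable functions $\mathbb R^d\to\{0,1\}$ such that, for all $k,m\ge1$ and $b\in\{0,1\}^m$, the set $\{(x_1,\dots,x_m): \exists f\in\mathcal F_k,\ f(x_i)=b_i \text{ for all } i\}$ is measurable for the completion of the law of $m$ independent copies of $X$ (this holds, for example, for countable classes). Put $$L_k^*=\inf_{f\in\mathcal F_k}L(f),\qquad \mathbb S_k(2n)=\max_{x_1,\dots,x_{2n}\in\mathbb R^d}\bigl|\{(f(x_1),\dots,f(x_{2n})): f\in\mathcal F_k\}\bigr| .$$ For each $k$ let $\hat f_k\in\mathcal F_k$ be a (data-dependent)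 minimizer of $\widehat L$ over $\mathcal F_k$, let $$\widehat C_k=2\sqrt{2\widehat L(\hat f_k)+8\,\frac{\log \mathbb S_k(2n)+2\log(nk)}{n}}\cdot\sqrt{\frac{\log \mathbb S_k(2n)}{n}+2\,\frac{\log(nk)}{n}},$$ let $\hat k\ge 1$ minimize $\widehat L(\hat f_k)+\widehat C_k$ over $k\ge1$, and let $\hat f=\hat f_{\hat k}$. Assume that $L(\hat f)$, the loss $L$ evaluated at the data-dependent rule $\hat f$, is a random variable. **Theorem 3.1.** For every $n\ge1$ and every distribution of $(X,Y)$, the random variables $L(\hat f)$ and $\widehat C_k$ ($k\ge1$) are integrable and $$\mathbb E L(\hat f)-L^*\le\inf_{k\ge1}\bigl(L_k^*-L^*+\mathbb E\widehat C_k\bigr)+\frac{16}{n^2}.$$ In particular, $$\mathbb E L(\hat f)-L^*\le\inf_{k\ge1}\left[L_k^*-L^*+4\sqrt{L_k^*+\frac2n\bigl\{\log\mathbb S_k(2n)+2\log(nk)\bigr\}}\cdot\sqrt{\frac{\log\mathbb S_k(2n)}{n}+2\,\frac{\log(nk)}{n}}\,\right]+\frac{16}{n^2}.$$ -/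

import Mathlib

open MeasureTheory ProbabilityTheory

noncomputable section

namespace PenalizedClassification

/-- The feature space `ℝ^d`. -/
abbrev Feature (d : ℕ) : Type := EuclideanSpace ℝ (Fin d)

/-- A classification rule `ℝ^d → {0,1}`, with `Bool` in the role of `{0,1}`. -/
abbrev Classifier (d : ℕ) : Type := Feature d → Bool

/-- The loss `L(f) = ℙ{f(X) ≠ Y}`, where `μ` is the law of `(X, Y)`. -/
def loss {d : ℕ} (μ : Measure (Feature d × Bool)) (f : Classifier d) : ℝ :=
  μ.real {z | f z.1 ≠ z.2}

/-- The Bayes loss `L^*`: the infimum of the loss over all (measurable) classification rules. -/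
def bayesLoss {d : ℕ} (μ : Measure (Feature d × Bool)) : ℝ :=
  sInf (loss μ '' {f : Classifier d | Measurable f})

/-- The minimal loss `inf_{f ∈ F} L(f)` in the class `F`. -/
def minLoss {d : ℕ} (μ : Measure (Feature d × Bool)) (F : Set (Classifier d)) : ℝ :=
  sInf (loss μ '' F)

/-- The empirical loss `(1/n) ∑ᵢ 𝕀{f(xᵢ) ≠ yᵢ}` of `f` on the sample `z = ((xᵢ, yᵢ))ᵢ`. -/
def empLoss {d n : ℕ} (z : Fin n → Feature d × Bool) (f : Classifier d) : ℝ :=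
  (1 / (n : ℝ)) * ∑ i, if f (z i).1 ≠ (z i).2 then 1 else 0

/-- The trace of `F` on `(x₁, …, x_m)`: all vectors `(f(x₁), …, f(x_m))` with `f ∈ F`. -/
def trace {d m : ℕ} (F : Set (Classifier d)) (x : Fin m → Feature d) : Set (Fin m → Bool) :=
  {b | ∃ f ∈ F, ∀ i, f (x i) = b i}

/-- The worst-case shatter coefficient: the maximum over `x₁, …, x_m` of the number of elements
of the trace (a maximum, as these numbers are at most `2 ^ m`). -/
def shatterCoeff {d : ℕ} (F : Set (Classifier d)) (m : ℕ) : ℕ :=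
  ⨆ x : Fin m → Feature d, (trace F x).ncard

/-- `f` minimizes the empirical loss on the sample `z` over the class `F`. -/
def IsEmpiricalMinimizer {d n : ℕ} (z : Fin n → Feature d × Bool) (F : Set (Classifier d))
    (f : Classifier d) : Prop :=
  f ∈ F ∧ ∀ g ∈ F, empLoss z f ≤ empLoss z g

/-- The penalty of the `k`-th class `F`, where `f` is the empirical loss minimizer in `F`. -/
def penalty {d n : ℕ} (z : Fin n → Feature d × Bool) (F : Set (Classifier d)) (k : ℕ+)
    (f : Classifier d) : ℝ :=
  2 * √(2 * empLoss z f
        + 8 * ((Real.log (shatterCoeff F (2 * n)) + 2 * Real.log (n * k)) / n))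
    * √(Real.log (shatterCoeff F (2 * n)) / n + 2 * (Real.log (n * k) / n))

/-- Regularity of a class of classifiers: its members are measurable functions, and the event that
a given bit vector `b` belongs to the trace of `F` on `m` independent points with law `ν` is
measurable (for the completion of the law of these points). Every countable class of measurable
functions has this property, for all `ν`. -/
structure IsRegularClass {d : ℕ} (ν : Measure (Feature d)) (F : Set (Classifier d)) : Prop where
  measurable : ∀ f ∈ F, Measurable f
  trace_measurable : ∀ (m : ℕ) (b : Fin m → Bool),
    NullMeasurableSet {x : Fin m → Feature d | b ∈ trace F x} (Measure.pi fun _ : Fin m => ν)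

end PenalizedClassification

end

/-! Each penalty is `deviation a x` with x the empirical loss and a the `complexity` of the class.
It suffices that, outside an event of probability at most 16/n², L(f) ≤ L̂(f) + penalty for all f in
all classes at once. There the loss of the selected rule is bounded by its own penalized empirical
loss, hence by that of the minimizer of any class k; on the exceptional event it is at most 1.
Taking expectations and using E L̂(f̂_k) ≤ L_k^* gives the first inequality; Jensen's inequality for
the square root gives the second.

The event is controlled by a relative Vapnik–Chervonenkis bound (`measure_exists_deviation_lt_le`):
one class fails with probability at most 4 S(2n) exp(-na). If f fails on the sample, an independent
ghost sample has empirical loss close to L(f) with probability at least 1/4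
(`measure_empLoss_lt_le`), so the two halves of the joined sample differ by much relative to the
total number of errors (`relative_gap_of_deviation_lt`). Randomly swapping the halves pair by pair
preserves the law and makes the difference a Rademacher sum whose variance is at most that total, so
Chernoff's bound and a union over at most S(2n) traces apply (`measure_ghostEvent_le`). The
complexity is chosen so that class k contributes 4/(nk)², which is summable. -/

namespace PenalizedClassification

open scoped ENNReal

/-! ### Random signs and swaps of error vectors. -/

/-- Chernoff bound for Rademacher sums, as a count of sign vectors. -/
lemma card_rademacher_ge_le {n : ℕ} (d : Fin n → ℝ) {c N r : ℝ} (hN : 0 < N)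
    (hd : ∑ i, d i ^ 2 ≤ N) (hc : 0 ≤ c) (hr : r = √(c * N)) :
    ((Finset.univ.filter fun s : Fin n → Bool =>
      r ≤ ∑ i, (if s i then -1 else 1) * d i).card : ℝ) ≤ 2 ^ n * Real.exp (-(c / 2)) := by
  classical
  -- The minimizer of l²N/2 - lr, the exponent in Chernoff's bound; its minimum is -c/2.
  set l : ℝ := r / N with hl
  have hr0 : 0 ≤ r := hr ▸ Real.sqrt_nonneg _
  have hl0 : 0 ≤ l := div_nonneg hr0 hN.le
  have hrsq : r ^ 2 = c * N := by rw [hr, Real.sq_sqrt (by positivity)]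
  have hsum : ∑ s : Fin n → Bool, Real.exp (l * ∑ i, (if s i then -1 else 1) * d i)
      ≤ 2 ^ n * Real.exp (l ^ 2 * N / 2) := by
    calc ∑ s : Fin n → Bool, Real.exp (l * ∑ i, (if s i then -1 else 1) * d i)
        = ∑ s : Fin n → Bool, ∏ i, Real.exp (l * ((if s i then -1 else 1) * d i)) := by
          simp_rw [Finset.mul_sum, Real.exp_sum]
      _ = ∏ i, ∑ b : Bool, Real.exp (l * ((if b then -1 else 1) * d i)) := by
          rw [Fintype.prod_sum]
      _ = ∏ i, (2 * Real.cosh (l * d i)) := by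
          refine Finset.prod_congr rfl fun i _ => ?_
          rw [Fintype.sum_bool, Real.cosh_eq]
          simp
          ring
      _ ≤ ∏ i, (2 * Real.exp ((l * d i) ^ 2 / 2)) :=
          Finset.prod_le_prod (fun i _ => by positivity)
            fun i _ => by gcongr; exact Real.cosh_le_exp_half_sq _
      _ = 2 ^ n * Real.exp (l ^ 2 * (∑ i, d i ^ 2) / 2) := by
          rw [Finset.prod_mul_distrib, ← Real.exp_sum, Finset.mul_sum, Finset.sum_div]
          simp [mul_pow]
      _ ≤ _ := by gcongr
  have hcount : ((Finset.univ.filter fun s : Fin n → Bool =>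
      r ≤ ∑ i, (if s i then -1 else 1) * d i).card : ℝ) * Real.exp (l * r)
      ≤ ∑ s : Fin n → Bool, Real.exp (l * ∑ i, (if s i then -1 else 1) * d i) := by
    rw [← nsmul_eq_mul]
    refine (Finset.card_nsmul_le_sum _ _ _ fun s hs => ?_).trans
      (Finset.sum_le_sum_of_subset_of_nonneg (Finset.subset_univ _)
        fun _ _ _ => (Real.exp_pos _).le)
    rw [Finset.mem_filter] at hs
    exact Real.exp_le_exp.2 (mul_le_mul_of_nonneg_left hs.2 hl0)
  have hlr : l * r = c := by rw [hl, div_mul_eq_mul_div, ← sq, hrsq]; field_simp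
  have hlN : l ^ 2 * N = c := by rw [hl, div_pow, hrsq]; field_simp
  rw [hlr] at hcount
  rw [hlN] at hsum
  have h := hcount.trans hsum
  rw [← le_div_iff₀ (Real.exp_pos _), mul_div_assoc, ← Real.exp_sub] at h
  convert! h using 3
  ring

/-- The involution of `Fin n × Bool` exchanging `(i, false)` and `(i, true)` where `s i` holds. -/
def swapPerm {n : ℕ} (s : Fin n → Bool) : Equiv.Perm (Fin n × Bool) :=
  Function.Involutive.toPerm (fun j => (j.1, xor (s j.1) j.2)) fun j => by simp

lemma swapPerm_apply {n : ℕ} (s : Fin n → Bool) (j : Fin n × Bool) :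
    swapPerm s j = (j.1, xor (s j.1) j.2) := rfl

/-- The second half of the error vector `u` is larger than the first half, by at least a constant
times the square root of the total. -/
def ExceedsBy {n : ℕ} (c : ℝ) (u : Fin n × Bool → ℝ) : Prop :=
  ∑ i, u (i, false) < ∑ i, u (i, true) ∧
    c * (∑ i, u (i, false) + ∑ i, u (i, true)) ≤ (∑ i, u (i, true) - ∑ i, u (i, false)) ^ 2

-- Swapping pair i negates the difference of its two entries and keeps their sum. The gap between
-- the halves is thus a Rademacher sum, and for entries in {0,1} the squared differences add up to
-- at most the total N.
open Classical in
lemma card_exceedsBy_swapPerm_le {n : ℕ} {c : ℝ} (hc : 0 ≤ c) (u : Fin n × Bool → ℝ)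
    (hu : ∀ j, u j = 0 ∨ u j = 1) :
    ((Finset.univ.filter fun s : Fin n → Bool => ExceedsBy c (u ∘ swapPerm s)).card : ℝ)
      ≤ 2 ^ n * Real.exp (-(c / 2)) := by
  set N : ℝ := ∑ i, (u (i, false) + u (i, true)) with hN
  have hu0 : ∀ j, 0 ≤ u j := fun j => by rcases hu j with h | h <;> simp [h]
  have htot : ∀ s : Fin n → Bool,
      ∑ i, (u ∘ swapPerm s) (i, false) + ∑ i, (u ∘ swapPerm s) (i, true) = N := fun s => by
    rw [← Finset.sum_add_distrib]
    refine Finset.sum_congr rfl fun i _ => ?_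
    cases h : s i <;> simp [swapPerm_apply, h, add_comm]
  have hdiff : ∀ s : Fin n → Bool,
      ∑ i, (u ∘ swapPerm s) (i, true) - ∑ i, (u ∘ swapPerm s) (i, false)
        = ∑ i, (if s i then -1 else 1) * (u (i, true) - u (i, false)) := fun s => by
    rw [← Finset.sum_sub_distrib]
    refine Finset.sum_congr rfl fun i _ => ?_
    cases h : s i <;> simp [swapPerm_apply, h]
  rcases (Finset.sum_nonneg fun i _ => add_nonneg (hu0 (i, false)) (hu0 (i, true)) :
    0 ≤ N).eq_or_lt with h0 | hpos
  -- With no errors at all, the strict inequality in `ExceedsBy` fails for every swap.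
  · rw [Finset.filter_false_of_mem]
    · simp; positivity
    · rintro s - ⟨hlt, -⟩
      have h1 : 0 ≤ ∑ i, (u ∘ swapPerm s) (i, false) := Finset.sum_nonneg fun i _ => hu0 _
      have := htot s
      linarith
  · refine le_trans ?_ (card_rademacher_ge_le (fun i => u (i, true) - u (i, false)) hpos ?_ hc rfl)
    · refine Nat.cast_le.2 (Finset.card_le_card fun s hs => ?_)
      simp only [Finset.mem_filter, Finset.mem_univ, true_and] at hs ⊢
      obtain ⟨h1, h2⟩ := hs
      rw [htot] at h2
      rw [← hdiff]
      exact Real.sqrt_le_left (by linarith) |>.2 h2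
    · refine Finset.sum_le_sum fun i _ => ?_
      rcases hu (i, false) with h | h <;> rcases hu (i, true) with h' | h' <;> norm_num [h, h']

/-! ### Product measures and their invariance under swaps. -/

section Product

variable {E : Type*} [MeasurableSpace E] (μ : Measure E) [IsProbabilityMeasure μ]

lemma measurePreserving_comp_equiv {ι κ : Type*} [Fintype ι] [Fintype κ] (e : ι ≃ κ) :
    MeasurePreserving (fun (w : κ → E) (i : ι) => w (e i))
      (Measure.pi fun _ => μ) (Measure.pi fun _ => μ) where
  measurable := by fun_prop
  map_eq := by
    refine (Measure.pi_eq fun s hs => ?_).symm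
    rw [Measure.map_apply (by fun_prop) (MeasurableSet.univ_pi hs)]
    have : (fun (w : κ → E) (i : ι) => w (e i)) ⁻¹' Set.univ.pi s
        = Set.univ.pi fun k => s (e.symm k) := by
      ext w
      simp only [Set.mem_preimage, Set.mem_univ_pi]
      exact ⟨fun h k => by simpa using h (e.symm k), fun h i => by simpa using h (e i)⟩
    rw [this, Measure.pi_pi]
    exact e.symm.prod_comp fun i => μ (s i)

/-- Two samples of the same size, joined to one. -/
def joinSamples {n : ℕ} (p : (Fin n → E) × (Fin n → E)) (j : Fin n × Bool) : E :=
  bif j.2 then p.2 j.1 else p.1 j.1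

lemma measurable_joinSamples {n : ℕ} : Measurable (joinSamples (E := E) (n := n)) := by
  refine measurable_pi_iff.2 fun j => ?_
  obtain ⟨i, b⟩ := j
  cases b <;> simp only [joinSamples, cond_true, cond_false] <;> fun_prop

lemma measurePreserving_joinSamples (n : ℕ) :
    MeasurePreserving (joinSamples (E := E) (n := n))
      ((Measure.pi fun _ => μ).prod (Measure.pi fun _ => μ)) (Measure.pi fun _ => μ) where
  measurable := measurable_joinSamples
  map_eq := by
    refine (Measure.pi_eq fun s hs => ?_).symm
    rw [Measure.map_apply measurable_joinSamples (MeasurableSet.univ_pi hs)]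
    have : joinSamples (E := E) (n := n) ⁻¹' Set.univ.pi s
        = (Set.univ.pi fun i => s (i, false)) ×ˢ (Set.univ.pi fun i => s (i, true)) := by
      ext p
      simp [joinSamples, forall_and]
    rw [this, Measure.prod_prod, Measure.pi_pi, Measure.pi_pi, Fintype.prod_prod_type]
    simp [Finset.prod_mul_distrib, mul_comm]

open Classical in
/-- An event of the joined sample has probability at most `q` if, for every sample, at most
a proportion `q` of the swaps leads into the event. -/
lemma measure_le_of_card_swapPerm_le {n : ℕ} {B : Set (Fin n × Bool → E)}
    (hB : NullMeasurableSet B (Measure.pi fun _ => μ)) {q : ℝ}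
    (h : ∀ w : Fin n × Bool → E,
      ((Finset.univ.filter fun s : Fin n → Bool => (fun j => w (swapPerm s j)) ∈ B).card : ℝ)
        ≤ 2 ^ n * q) :
    (Measure.pi fun _ => μ) B ≤ ENNReal.ofReal q := by
  set ρ : Measure (Fin n × Bool → E) := Measure.pi fun _ => μ
  have hT : ∀ s : Fin n → Bool,
      MeasurePreserving (fun (w : Fin n × Bool → E) j => w (swapPerm s j)) ρ ρ :=
    fun s => measurePreserving_comp_equiv μ (swapPerm s)
  -- Every swap preserves ρ, so all 2ⁿ preimages of B have the same measure, and the sum of their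
  -- indicators is the count bounded in `h`.
  have hsum : (2 : ℝ≥0∞) ^ n * ρ B
      = ∫⁻ w, ∑ s : Fin n → Bool,
          ((fun (w : Fin n × Bool → E) j => w (swapPerm s j)) ⁻¹' B).indicator 1 w ∂ρ := by
    rw [lintegral_finsetSum']
    · have : ∀ s : Fin n → Bool, ∫⁻ w,
          ((fun (w : Fin n × Bool → E) j => w (swapPerm s j)) ⁻¹' B).indicator 1 w ∂ρ = ρ B :=
        fun s => by
          rw [lintegral_indicator_one₀ (hB.preimage (hT s).quasiMeasurePreserving),
            (hT s).measure_preimage hB]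
      simp [this]
    · exact fun s _ => aemeasurable_const.indicator₀ (hB.preimage (hT s).quasiMeasurePreserving)
  have hle : (2 : ℝ≥0∞) ^ n * ρ B ≤ 2 ^ n * ENNReal.ofReal q := by
    rw [hsum]
    calc _ ≤ ∫⁻ _, ENNReal.ofReal (2 ^ n * q) ∂ρ := by
          refine lintegral_mono fun w => ?_
          refine le_trans (le_of_eq ?_) (ENNReal.ofReal_le_ofReal (h w))
          simp [Set.indicator_apply]
      _ = _ := by
          rw [ENNReal.ofReal_mul (by positivity), ENNReal.ofReal_pow (by norm_num)]
          simp
  exact (ENNReal.mul_le_mul_iff_right (by simp) (by simp)).1 hle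

end Product

/-! ### Traces, the ghost sample, and moments of the empirical loss. -/

section Symmetrization

variable {d : ℕ}

lemma ncard_trace_le_shatterCoeff (F : Set (Classifier d)) {m : ℕ} (x : Fin m → Feature d) :
    (trace F x).ncard ≤ shatterCoeff F m := by
  -- An unbounded supremum in ℕ would be 0, so the bound 2 ^ m is essential here.
  refine le_ciSup (f := fun x : Fin m → Feature d => (trace F x).ncard) ⟨2 ^ m, ?_⟩ x
  rintro _ ⟨x, rfl⟩
  refine (Set.ncard_le_ncard (Set.subset_univ _)).trans ?_
  simp [Set.ncard_univ]

lemma one_le_shatterCoeff {F : Set (Classifier d)} (hF : F.Nonempty) (m : ℕ) :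
    1 ≤ shatterCoeff F m := by
  obtain ⟨f, hf⟩ := hF
  let x : Fin m → Feature d := 0
  refine le_trans ?_ (ncard_trace_le_shatterCoeff F x)
  rw [Nat.one_le_iff_ne_zero, Ne, Set.ncard_eq_zero (Set.toFinite _)]
  exact Set.Nonempty.ne_empty ⟨fun i => f (x i), f, hf, fun _ => rfl⟩

/-- The trace of `F` on points with an arbitrary index type. -/
def indexedTrace {ι : Type*} (F : Set (Classifier d)) (x : ι → Feature d) : Set (ι → Bool) :=
  {b | ∃ f ∈ F, ∀ i, f (x i) = b i}

lemma ncard_indexedTrace_le {ι : Type*} [Fintype ι] (F : Set (Classifier d)) (x : ι → Feature d) :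
    (indexedTrace F x).ncard ≤ shatterCoeff F (Fintype.card ι) := by
  let e := (Fintype.equivFin ι).symm
  refine le_trans ?_ (ncard_trace_le_shatterCoeff F (x ∘ e))
  refine Set.ncard_le_ncard_of_injOn (fun b => b ∘ e) ?_ ?_ (Set.toFinite _)
  · rintro b ⟨f, hf, h⟩
    exact ⟨f, hf, fun i => h (e i)⟩
  · intro b _ b' _ h
    exact e.surjective.injective_comp_right h

lemma IsRegularClass.nullMeasurableSet_indexedTrace {μ : Measure (Feature d × Bool)}
    [IsProbabilityMeasure μ] {F : Set (Classifier d)} (hF : IsRegularClass μ.fst F)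
    {ι : Type*} [Fintype ι] (b : ι → Bool) :
    NullMeasurableSet {w : ι → Feature d × Bool | b ∈ indexedTrace F fun i => (w i).1}
      (Measure.pi fun _ => μ) := by
  let e := (Fintype.equivFin ι).symm
  have h1 : MeasurePreserving (fun (w : ι → Feature d × Bool) i => (w (e i)).1)
      (Measure.pi fun _ => μ) (Measure.pi fun _ => μ.fst) :=
    (measurePreserving_pi (fun _ => μ) (fun _ => μ.fst)
      fun _ => ⟨measurable_fst, rfl⟩).comp (measurePreserving_comp_equiv μ e)
  convert! (hF.trace_measurable _ (b ∘ e)).preimage h1.quasiMeasurePreserving using 1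
  ext w
  simp only [Set.mem_ofPred_eq, Set.mem_preimage, indexedTrace, trace]
  refine exists_congr fun f => and_congr_right fun _ => ?_
  exact ⟨fun h i => h (e i), fun h i => by simpa using h (e.symm i)⟩

/-- The errors of predicted labels `b` on a sample `w`. -/
def errors {ι : Type*} (w : ι → Feature d × Bool) (b : ι → Bool) (i : ι) : ℝ :=
  if b i ≠ (w i).2 then 1 else 0

lemma measurable_errors {ι : Type*} (b : ι → Bool) :
    Measurable fun w : ι → Feature d × Bool => errors w b := by
  refine measurable_pi_iff.2 fun i => ?_
  exact (measurable_from_top (f := fun y : Bool => if b i ≠ y then (1 : ℝ) else 0)).comp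
    (measurable_snd.comp (measurable_pi_apply i))

/-- The event that some `f ∈ F` makes many more errors on the second half of a joined sample
than on the first. -/
def ghostEvent (F : Set (Classifier d)) (n : ℕ) (c : ℝ) : Set (Fin n × Bool → Feature d × Bool) :=
  {w | ∃ b ∈ indexedTrace F fun j => (w j).1, ExceedsBy c (errors w b)}

/-- Errors depend on f only through its trace, so the event is a finite union over label vectors
even when F is uncountable. -/
lemma nullMeasurableSet_ghostEvent {μ : Measure (Feature d × Bool)}
    [IsProbabilityMeasure μ] {F : Set (Classifier d)} (hF : IsRegularClass μ.fst F) (n : ℕ)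
    (c : ℝ) : NullMeasurableSet (ghostEvent F n c) (Measure.pi fun _ => μ) := by
  have : ghostEvent F n c = ⋃ b : Fin n × Bool → Bool,
      {w : Fin n × Bool → Feature d × Bool | b ∈ indexedTrace F fun i => (w i).1}
        ∩ {w | ExceedsBy c (errors w b)} := by
    ext w; simp [ghostEvent]
  rw [this]
  refine NullMeasurableSet.iUnion fun b => (hF.nullMeasurableSet_indexedTrace b).inter
    (MeasurableSet.nullMeasurableSet ?_)
  have hm : ∀ j, Measurable fun w : Fin n × Bool → Feature d × Bool => errors w b j :=
    fun j => (measurable_pi_apply j).comp (measurable_errors b)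
  have h1 : Measurable fun w : Fin n × Bool → Feature d × Bool => ∑ i, errors w b (i, false) :=
    Finset.measurable_sum _ fun i _ => hm _
  have h2 : Measurable fun w : Fin n × Bool → Feature d × Bool => ∑ i, errors w b (i, true) :=
    Finset.measurable_sum _ fun i _ => hm _
  exact (measurableSet_lt h1 h2).inter
    (measurableSet_le ((h1.add h2).const_mul c) ((h2.sub h1).pow_const 2))

/-- For a fixed joined sample, the classifiers give at most S(2n) error vectors, and swapping the
sample merely permutes each of them. A union bound over these vectors therefore suffices. -/
lemma measure_ghostEvent_le {μ : Measure (Feature d × Bool)}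
    [IsProbabilityMeasure μ] {F : Set (Classifier d)} (hF : IsRegularClass μ.fst F) (n : ℕ)
    {c : ℝ} (hc : 0 ≤ c) :
    (Measure.pi fun _ => μ) (ghostEvent F n c)
      ≤ ENNReal.ofReal (shatterCoeff F (2 * n) * Real.exp (-(c / 2))) := by
  classical
  refine measure_le_of_card_swapPerm_le μ (nullMeasurableSet_ghostEvent hF n c) fun w => ?_
  set T : Finset (Fin n × Bool → Bool) :=
    (Set.toFinite (indexedTrace F fun j => (w j).1)).toFinset with hT
  have hTcard : (T.card : ℝ) ≤ shatterCoeff F (2 * n) := by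
    rw [hT, ← Set.ncard_eq_toFinset_card]
    have := ncard_indexedTrace_le F fun j => (w j).1
    rw [Fintype.card_prod, Fintype.card_fin, Fintype.card_bool, mul_comm] at this
    exact_mod_cast this
  have hsub : (Finset.univ.filter fun s : Fin n → Bool =>
        (fun j => w (swapPerm s j)) ∈ ghostEvent F n c)
      ⊆ T.biUnion fun b => Finset.univ.filter fun s : Fin n → Bool =>
          ExceedsBy c (errors w b ∘ swapPerm s) := by
    intro s hs
    simp only [Finset.mem_filter, Finset.mem_univ, true_and, Finset.mem_biUnion] at hs ⊢
    obtain ⟨b, ⟨f, hf, hfb⟩, hb⟩ := hs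
    -- The trace of f on the unswapped sample, so that the union does not depend on s.
    refine ⟨fun j => f (w j).1, ?_, ?_⟩
    · simp only [hT, Set.Finite.mem_toFinset]
      exact ⟨f, hf, fun _ => rfl⟩
    · convert! hb using 1
      ext j
      simp only [Function.comp_apply, errors, ← hfb]
  calc _ ≤ ((T.biUnion fun b => Finset.univ.filter fun s : Fin n → Bool =>
          ExceedsBy c (errors w b ∘ swapPerm s)).card : ℝ) :=
        Nat.cast_le.2 (Finset.card_le_card hsub)
    _ ≤ ∑ b ∈ T, ((Finset.univ.filter fun s : Fin n → Bool =>
          ExceedsBy c (errors w b ∘ swapPerm s)).card : ℝ) := by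
        exact_mod_cast Finset.card_biUnion_le
    _ ≤ ∑ b ∈ T, 2 ^ n * Real.exp (-(c / 2)) :=
        Finset.sum_le_sum fun b _ => card_exceedsBy_swapPerm_le hc _ fun j => by
          unfold errors; split_ifs <;> simp
    _ = T.card * (2 ^ n * Real.exp (-(c / 2))) := by rw [Finset.sum_const, nsmul_eq_mul]
    _ ≤ shatterCoeff F (2 * n) * (2 ^ n * Real.exp (-(c / 2))) := by gcongr
    _ = _ := by ring

lemma empLoss_eq_errors {n : ℕ} (z : Fin n → Feature d × Bool) (f : Classifier d) :
    empLoss z f = (∑ i, errors z (fun i => f (z i).1) i) / n := by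
  rw [empLoss, one_div, inv_mul_eq_div]
  rfl

lemma empLoss_nonneg {n : ℕ} (z : Fin n → Feature d × Bool) (f : Classifier d) :
    0 ≤ empLoss z f := by
  unfold empLoss
  exact mul_nonneg (by positivity) (Finset.sum_nonneg fun i _ => by split_ifs <;> simp)

lemma empLoss_le_one {n : ℕ} (z : Fin n → Feature d × Bool) (f : Classifier d) :
    empLoss z f ≤ 1 := by
  rw [empLoss_eq_errors]
  refine div_le_one_of_le₀ ?_ (Nat.cast_nonneg n)
  calc _ ≤ ∑ _i : Fin n, (1 : ℝ) :=
        Finset.sum_le_sum fun i _ => by unfold errors; split_ifs <;> simp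
    _ = n := by simp

lemma loss_nonneg (μ : Measure (Feature d × Bool)) (f : Classifier d) : 0 ≤ loss μ f :=
  measureReal_nonneg

lemma loss_le_one (μ : Measure (Feature d × Bool)) [IsProbabilityMeasure μ] (f : Classifier d) :
    loss μ f ≤ 1 := measureReal_le_one

section SingleClassifier

variable {μ : Measure (Feature d × Bool)} {f : Classifier d}

/-- The indicator of the misclassification event. -/
noncomputable def errorIndicator (f : Classifier d) : Feature d × Bool → ℝ :=
  {p : Feature d × Bool | f p.1 ≠ p.2}.indicator 1

lemma measurableSet_error (hf : Measurable f) :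
    MeasurableSet {p : Feature d × Bool | f p.1 ≠ p.2} :=
  (measurableSet_eq_fun (hf.comp measurable_fst) measurable_snd).compl

lemma measurable_errorIndicator (hf : Measurable f) : Measurable (errorIndicator f) :=
  measurable_one.indicator (measurableSet_error hf)

lemma integral_errorIndicator (hf : Measurable f) : ∫ p, errorIndicator f p ∂μ = loss μ f := by
  rw [errorIndicator, integral_indicator_one (measurableSet_error hf), loss]

variable [IsProbabilityMeasure μ]

lemma memLp_errorIndicator (hf : Measurable f) (q : ℝ≥0∞) : MemLp (errorIndicator f) q μ := by
  refine MemLp.of_bound (measurable_errorIndicator hf).aestronglyMeasurable 1 (.of_forall fun p => ?_)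
  unfold errorIndicator Set.indicator
  split_ifs <;> simp

lemma empLoss_eq_sum_errorIndicator {n : ℕ} (z : Fin n → Feature d × Bool) (f : Classifier d) :
    empLoss z f = (1 / (n : ℝ)) * ∑ i, errorIndicator f (z i) := by
  simp [empLoss, errorIndicator, Set.indicator_apply]

lemma measurable_empLoss {n : ℕ} (hf : Measurable f) :
    Measurable fun z : Fin n → Feature d × Bool => empLoss z f := by
  simp_rw [empLoss_eq_sum_errorIndicator]
  exact (Finset.measurable_sum _ fun i _ =>
    (measurable_errorIndicator hf).comp (measurable_pi_apply i)).const_mul _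

lemma memLp_empLoss {n : ℕ} (hf : Measurable f) (q : ℝ≥0∞) :
    MemLp (fun z : Fin n → Feature d × Bool => empLoss z f) q (Measure.pi fun _ => μ) :=
  MemLp.of_bound (measurable_empLoss hf).aestronglyMeasurable 1 (.of_forall fun z => by
    rw [Real.norm_of_nonneg (empLoss_nonneg z f)]
    exact empLoss_le_one z f)

lemma integral_empLoss {n : ℕ} (hn : 1 ≤ n) (hf : Measurable f) :
    ∫ z : Fin n → Feature d × Bool, empLoss z f ∂(Measure.pi fun _ => μ) = loss μ f := by
  simp_rw [empLoss_eq_sum_errorIndicator]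
  rw [integral_const_mul, integral_finsetSum]
  · have : ∀ i : Fin n, ∫ z : Fin n → Feature d × Bool, errorIndicator f (z i)
        ∂(Measure.pi fun _ => μ) = loss μ f := fun i => by
      rw [integral_comp_eval (μ := fun _ : Fin n => μ)
        (measurable_errorIndicator hf).aestronglyMeasurable, integral_errorIndicator hf]
    have hn' : (n : ℝ) ≠ 0 := by positivity
    simp [this, hn']
  · exact fun i _ => integrable_comp_eval (μ := fun _ : Fin n => μ)
      ((memLp_errorIndicator hf 1).integrable le_rfl)

/-- An indicator equals its square, so its variance is at most its mean. Keeping the factor L is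
what makes the deviation bound relative. -/
lemma variance_empLoss_le {n : ℕ} (hn : 1 ≤ n) (hf : Measurable f) :
    Var[fun z : Fin n → Feature d × Bool => empLoss z f; Measure.pi fun _ => μ]
      ≤ loss μ f / n := by
  simp_rw [empLoss_eq_sum_errorIndicator]
  rw [variance_const_mul]
  have hsum : Var[fun z : Fin n → Feature d × Bool => ∑ i, errorIndicator f (z i);
      Measure.pi fun _ => μ] = n * Var[errorIndicator f; μ] := by
    have := variance_sum_pi (μ := fun _ : Fin n => μ) (X := fun _ => errorIndicator f)
      fun _ => memLp_errorIndicator hf 2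
    rw [Finset.sum_fn] at this
    rw [this]
    simp
  have hvar : Var[errorIndicator f; μ] ≤ loss μ f := by
    refine (variance_le_expectation_sq
      (measurable_errorIndicator hf).aestronglyMeasurable).trans (le_of_eq ?_)
    rw [← integral_errorIndicator hf]
    congr 1
    ext p
    by_cases h : f p.1 = p.2 <;> simp [errorIndicator, h]
  rw [hsum]
  have hn' : (0 : ℝ) < n := by positivity
  calc (1 / (n : ℝ)) ^ 2 * (n * Var[errorIndicator f; μ])
      ≤ (1 / (n : ℝ)) ^ 2 * (n * loss μ f) := by gcongr
    _ = _ := by field_simp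

/-- A one-sided Chebyshev bound for the lower tail of the empirical loss. -/
lemma measure_empLoss_lt_le {n : ℕ} (hn : 1 ≤ n) (hf : Measurable f) {t : ℝ} (ht : 0 < t)
    (h : loss μ f / n ≤ 3 * t ^ 2) :
    (Measure.pi fun _ => μ) {z : Fin n → Feature d × Bool | empLoss z f < loss μ f - t}
      ≤ ENNReal.ofReal (3 / 4) := by
  set ν : Measure (Fin n → Feature d × Bool) := Measure.pi fun _ => μ
  have hmem : MemLp (fun z : Fin n → Feature d × Bool => loss μ f - empLoss z f) 2 ν :=
    (memLp_const _).sub (memLp_empLoss hf 2)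
  have hvar : ∫ z, (loss μ f - empLoss z f) ^ 2 ∂ν ≤ 3 * t ^ 2 := by
    refine le_trans (le_of_eq ?_) ((variance_empLoss_le (μ := μ) hn hf).trans h)
    rw [variance_eq_integral (measurable_empLoss hf).aemeasurable, integral_empLoss hn hf]
    exact integral_congr_ae (.of_forall fun z => by dsimp only; ring)
  have hint1 : Integrable (fun z => (loss μ f - empLoss z f) ^ 2) ν := hmem.integrable_sq
  have hint2 : Integrable (fun z => loss μ f - empLoss z f) ν := hmem.integrable (by norm_num)
  have hmean : ∫ z, (loss μ f - empLoss z f) ∂ν = 0 := by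
    rw [integral_sub (integrable_const _) ((memLp_empLoss hf 1).integrable le_rfl),
      integral_empLoss hn hf]
    simp
  -- Cantelli's trick: the shift 3t gives second moment at most 3t² + 9t² = 12t², while the event
  -- forces the square above 16t². The ratio is 3/4.
  have hsq : (fun z : Fin n → Feature d × Bool => (loss μ f - empLoss z f + 3 * t) ^ 2)
      = fun z => (loss μ f - empLoss z f) ^ 2 + 6 * t * (loss μ f - empLoss z f) + 9 * t ^ 2 := by
    ext z; ring
  have hint12 : Integrable (fun z : Fin n → Feature d × Bool =>
      (loss μ f - empLoss z f) ^ 2 + 6 * t * (loss μ f - empLoss z f)) ν :=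
    hint1.add (hint2.const_mul _)
  have hint : Integrable (fun z => (loss μ f - empLoss z f + 3 * t) ^ 2) ν := by
    rw [hsq]
    exact hint12.add (integrable_const _)
  have hmom : ∫ z, (loss μ f - empLoss z f + 3 * t) ^ 2 ∂ν ≤ 12 * t ^ 2 := by
    rw [hsq, integral_add hint12 (integrable_const _),
      integral_add hint1 (hint2.const_mul _), integral_const_mul, hmean]
    simp
    linarith
  have hmarkov := mul_meas_ge_le_integral_of_nonneg
    (.of_forall fun z => sq_nonneg (loss μ f - empLoss z f + 3 * t)) hint (16 * t ^ 2)
  have hsub : {z : Fin n → Feature d × Bool | empLoss z f < loss μ f - t}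
      ⊆ {z | 16 * t ^ 2 ≤ (loss μ f - empLoss z f + 3 * t) ^ 2} := fun z hz => by
    simp only [Set.mem_ofPred_eq] at hz ⊢
    nlinarith
  rw [← ofReal_measureReal (by finiteness)]
  refine ENNReal.ofReal_le_ofReal ((measureReal_mono hsub).trans ?_)
  have ht2 : 0 < t ^ 2 := by positivity
  nlinarith

end SingleClassifier

end Symmetrization

/-! ### The relative deviation inequality. -/

section Oracle

variable {d n : ℕ}

/-- The margin by which the loss may exceed an empirical loss `x`, at complexity `a`. -/
noncomputable def deviation (a x : ℝ) : ℝ := 2 * √(2 * x + 8 * a) * √a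

lemma deviation_nonneg (a x : ℝ) : 0 ≤ deviation a x := by unfold deviation; positivity

lemma sq_deviation {a x : ℝ} (ha : 0 ≤ a) (hx : 0 ≤ x) :
    deviation a x ^ 2 = 8 * a * x + 32 * a ^ 2 := by
  rw [deviation, mul_pow, mul_pow, Real.sq_sqrt (by positivity), Real.sq_sqrt ha]
  ring

/-- If `x = L̂` and `D = L - L̂` exceeds the margin, then `D` dominates the variance of the
empirical loss, and a second empirical loss `y ≥ L - D / 4` exceeds `x` in the relative sense. -/
lemma relative_gap_of_deviation_lt {a x L y : ℝ} (ha : 0 < a) (hx : 0 ≤ x)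
    (h : x + deviation a x < L) (hy : L - (L - x) / 4 ≤ y) :
    x < y ∧ 2 * a * (x + y) ≤ (y - x) ^ 2 := by
  have h0 := deviation_nonneg a x
  have hsq := sq_deviation ha.le hx
  obtain ⟨D, hD⟩ : ∃ D, D = L - x := ⟨_, rfl⟩
  have hDd : deviation a x < D := by linarith
  have hD2 : 8 * a * x + 32 * a ^ 2 ≤ D ^ 2 := by nlinarith
  have hDa : 4 * a ≤ D := by nlinarith
  have hyx : 3 / 4 * D ≤ y - x := by linarith
  refine ⟨by linarith, ?_⟩
  -- The map t ↦ t² - 2at increases for t ≥ a, and 3D/4 ≥ 3a. Since x + y = 2x + (y - x), it remains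
  -- to bound 4ax by its value at 3D/4; after 4ax ≤ D²/2 - 16a² the slack is (D/4 - 3a)² + 7a².
  have hmono : (3 / 4 * D) ^ 2 - 2 * a * (3 / 4 * D) ≤ (y - x) ^ 2 - 2 * a * (y - x) := by
    nlinarith
  nlinarith [sq_nonneg (D / 4 - 3 * a)]

lemma loss_le_sq_of_deviation_lt {a x L : ℝ} (ha : 0 < a) (hx : 0 ≤ x)
    (h : x + deviation a x < L) : 16 * a * L ≤ 3 * (L - x) ^ 2 := by
  have h0 := deviation_nonneg a x
  have hsq := sq_deviation ha.le hx
  obtain ⟨D, hD⟩ : ∃ D, D = L - x := ⟨_, rfl⟩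
  have hDd : deviation a x < D := by linarith
  have hD2 : 8 * a * x + 32 * a ^ 2 ≤ D ^ 2 := by nlinarith
  rw [← hD]
  nlinarith [sq_nonneg (D - 8 * a)]

/-- A relative uniform deviation inequality of Vapnik–Chervonenkis type. -/
lemma measure_exists_deviation_lt_le {μ : Measure (Feature d × Bool)} [IsProbabilityMeasure μ]
    {F : Set (Classifier d)} (hF : IsRegularClass μ.fst F) (hne : F.Nonempty) (hn : 1 ≤ n)
    {a : ℝ} (ha : 0 ≤ a) :
    (Measure.pi fun _ => μ)
        {z : Fin n → Feature d × Bool | ∃ f ∈ F, empLoss z f + deviation a (empLoss z f) < loss μ f}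
      ≤ ENNReal.ofReal (4 * (shatterCoeff F (2 * n) * Real.exp (-(n * a)))) := by
  set ν : Measure (Fin n → Feature d × Bool) := Measure.pi fun _ => μ
  set ρ : Measure (Fin n × Bool → Feature d × Bool) := Measure.pi fun _ => μ
  have hn0 : (0 : ℝ) < n := by exact_mod_cast hn
  have hS : (1 : ℝ) ≤ shatterCoeff F (2 * n) := by exact_mod_cast one_le_shatterCoeff hne (2 * n)
  -- For na < 1 the right-hand side exceeds 4/e > 1 and the bound is trivial.
  rcases lt_or_ge (n * a) 1 with hna | hna
  · refine prob_le_one.trans (ENNReal.one_le_ofReal.2 ?_)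
    have h1 : Real.exp (-1) ≤ Real.exp (-(n * a)) := Real.exp_le_exp.2 (by linarith)
    have h2 := Real.exp_neg_one_gt_d9
    nlinarith
  have ha0 : 0 < a := by
    rcases ha.eq_or_lt with rfl | h
    · norm_num at hna
    · exact h
  -- The ghost event is only null measurable; a measurable hull makes its sections accessible to
  -- Fubini. The constant 2na turns exp(-c/2) into exp(-na).
  set C : Set ((Fin n → Feature d × Bool) × (Fin n → Feature d × Bool)) :=
    joinSamples ⁻¹' toMeasurable ρ (ghostEvent F n (2 * (n * a))) with hC
  have hCmeas : MeasurableSet C := measurable_joinSamples (measurableSet_toMeasurable _ _)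
  have hCle : (ν.prod ν) C
      ≤ ENNReal.ofReal (shatterCoeff F (2 * n) * Real.exp (-(n * a))) := by
    rw [hC, (measurePreserving_joinSamples μ n).measure_preimage
      (measurableSet_toMeasurable _ _).nullMeasurableSet, measure_toMeasurable]
    refine (measure_ghostEvent_le hF n (by positivity)).trans (le_of_eq ?_)
    congr 4
    ring
  have hsub : {z : Fin n → Feature d × Bool |
        ∃ f ∈ F, empLoss z f + deviation a (empLoss z f) < loss μ f}
      ⊆ {z | ENNReal.ofReal (1 / 4) ≤ ν (Prod.mk z ⁻¹' C)} := by
    rintro z ⟨f, hf, hz⟩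
    have hfm := hF.measurable f hf
    have hgap : 0 < loss μ f - empLoss z f := by linarith [deviation_nonneg a (empLoss z f)]
    -- With D = L - L̂ and t = D/4, the variance condition L/n ≤ 3t² follows from 16aL ≤ 3D² and na
    -- ≥ 1.
    have htail := measure_empLoss_lt_le (μ := μ) hn hfm (t := (loss μ f - empLoss z f) / 4)
      (by positivity) (by
        have := loss_le_sq_of_deviation_lt ha0 (empLoss_nonneg z f) hz
        rw [div_le_iff₀ hn0]
        have h2 : loss μ f ≤ (n * a) * loss μ f := by nlinarith [loss_nonneg μ f]
        nlinarith)
    have hcompl : {z' : Fin n → Feature d × Bool |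
          empLoss z' f < loss μ f - (loss μ f - empLoss z f) / 4}ᶜ ⊆ Prod.mk z ⁻¹' C := by
      intro z' hz'
      simp only [Set.mem_compl_iff, Set.mem_ofPred_eq, not_lt] at hz'
      refine subset_toMeasurable _ _ ⟨fun j => f (joinSamples (z, z') j).1, ⟨f, hf, fun _ => rfl⟩, ?_⟩
      obtain ⟨h1, h2⟩ := relative_gap_of_deviation_lt ha0 (empLoss_nonneg z f) hz hz'
      have e1 : ∑ i, errors (joinSamples (z, z')) (fun j => f (joinSamples (z, z') j).1) (i, false)
          = n * empLoss z f := by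
        rw [empLoss_eq_errors, mul_div_cancel₀ _ hn0.ne']; rfl
      have e2 : ∑ i, errors (joinSamples (z, z')) (fun j => f (joinSamples (z, z') j).1) (i, true)
          = n * empLoss z' f := by
        rw [empLoss_eq_errors, mul_div_cancel₀ _ hn0.ne']; rfl
      unfold ExceedsBy
      rw [e1, e2]
      refine ⟨by gcongr, ?_⟩
      have := mul_le_mul_of_nonneg_left h2 (sq_nonneg (n : ℝ))
      nlinarith
    refine le_trans ?_ (measure_mono hcompl)
    rw [prob_compl_eq_one_sub (measurableSet_lt (measurable_empLoss hfm) measurable_const)]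
    refine le_trans ?_ (tsub_le_tsub_left htail 1)
    rw [← ENNReal.ofReal_one, ← ENNReal.ofReal_sub _ (by norm_num)]
    norm_num
  -- Bad samples have sections of measure at least 1/4, so Markov's inequality costs the factor 4.
  have hmarkov := mul_meas_ge_le_lintegral (μ := ν) (measurable_measure_prodMk_left (ν := ν) hCmeas)
    (ENNReal.ofReal (1 / 4))
  rw [← Measure.prod_apply hCmeas] at hmarkov
  have h4 : ENNReal.ofReal 4 * ENNReal.ofReal (1 / 4) = 1 := by
    rw [← ENNReal.ofReal_mul (by norm_num)]; norm_num
  calc _ ≤ ν {z | ENNReal.ofReal (1 / 4) ≤ ν (Prod.mk z ⁻¹' C)} := measure_mono hsub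
    _ = ENNReal.ofReal 4 * (ENNReal.ofReal (1 / 4)
          * ν {z | ENNReal.ofReal (1 / 4) ≤ ν (Prod.mk z ⁻¹' C)}) := by
        rw [← mul_assoc, h4, one_mul]
    _ ≤ ENNReal.ofReal 4 * ENNReal.ofReal (shatterCoeff F (2 * n) * Real.exp (-(n * a))) := by
        gcongr
        exact hmarkov.trans hCle
    _ = _ := (ENNReal.ofReal_mul (by norm_num)).symm

/-! ### The union bound over the classes. -/

/-- The complexity term of the `k`-th class `F` at sample size `n`. -/
noncomputable def complexity (n : ℕ) (F : Set (Classifier d)) (k : ℕ+) : ℝ :=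
  (Real.log (shatterCoeff F (2 * n)) + 2 * Real.log (n * k)) / n

lemma penalty_eq_deviation (z : Fin n → Feature d × Bool) (F : Set (Classifier d)) (k : ℕ+)
    (f : Classifier d) : penalty z F k f = deviation (complexity n F k) (empLoss z f) := by
  have : Real.log (shatterCoeff F (2 * n)) / n + 2 * (Real.log (n * k) / n)
      = complexity n F k := by unfold complexity; ring
  rw [penalty, this]
  rfl

lemma one_le_mul_pnat (hn : 1 ≤ n) (k : ℕ+) : (1 : ℝ) ≤ n * k := by
  exact_mod_cast Nat.mul_pos hn k.pos

lemma complexity_nonneg (hn : 1 ≤ n) (F : Set (Classifier d)) (k : ℕ+) :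
    0 ≤ complexity n F k := by
  have h1 := Real.log_nonneg (one_le_mul_pnat hn k)
  have h2 := Real.log_natCast_nonneg (shatterCoeff F (2 * n))
  unfold complexity
  positivity

/-- The reason for the form of the complexity: log S cancels the number of traces, and 2 log(nk)
leaves a summable weight. -/
lemma shatterCoeff_mul_exp_neg_complexity (hn : 1 ≤ n) {F : Set (Classifier d)}
    (hne : F.Nonempty) (k : ℕ+) :
    shatterCoeff F (2 * n) * Real.exp (-(n * complexity n F k)) = 1 / (n * k : ℝ) ^ 2 := by
  have hn0 : (n : ℝ) ≠ 0 := by positivity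
  have hS : (0 : ℝ) < shatterCoeff F (2 * n) := by
    exact_mod_cast one_le_shatterCoeff hne (2 * n)
  have hk : (0 : ℝ) < n * k := zero_lt_one.trans_le (one_le_mul_pnat hn k)
  have : -(n * complexity n F k)
      = -Real.log (shatterCoeff F (2 * n)) + -(2 * Real.log (n * k)) := by
    unfold complexity; field_simp; ring
  rw [this, Real.exp_add, Real.exp_neg, Real.exp_neg, Real.exp_log hS,
    show 2 * Real.log (n * k) = Real.log ((n * k : ℝ) ^ 2) by rw [Real.log_pow]; norm_num,
    Real.exp_log (by positivity), ← mul_assoc, mul_inv_cancel₀ hS.ne', one_mul, one_div]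

/-- The value π²/6 is rounded up to 4; with the factor 4 of the deviation inequality this gives the
constant 16. -/
lemma tsum_ofReal_inv_sq_pnat_le :
    ∑' k : ℕ+, ENNReal.ofReal (1 / (k : ℝ) ^ 2) ≤ ENNReal.ofReal 4 := by
  have hz := hasSum_zeta_two
  calc ∑' k : ℕ+, ENNReal.ofReal (1 / (k : ℝ) ^ 2)
      ≤ ∑' k : ℕ, ENNReal.ofReal (1 / (k : ℝ) ^ 2) :=
        ENNReal.tsum_comp_le_tsum_of_injective PNat.coe_injective
          fun k : ℕ => ENNReal.ofReal (1 / (k : ℝ) ^ 2)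
    _ = ENNReal.ofReal (Real.pi ^ 2 / 6) := by
        rw [← ENNReal.ofReal_tsum_of_nonneg (fun _ => by positivity) hz.summable, hz.tsum_eq]
    _ ≤ ENNReal.ofReal 4 := by
        refine ENNReal.ofReal_le_ofReal ?_
        nlinarith [Real.pi_le_four, Real.pi_pos]

/-- Outside of an event of probability at most `16 / n ^ 2`, the loss of every classifier of every
class is at most its penalized empirical loss. -/
lemma exists_measurableSet_deviation {μ : Measure (Feature d × Bool)} [IsProbabilityMeasure μ]
    (hn : 1 ≤ n) {F : ℕ+ → Set (Classifier d)} (hF : ∀ k, IsRegularClass μ.fst (F k))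
    (hne : ∀ k, (F k).Nonempty) :
    ∃ A : Set (Fin n → Feature d × Bool), MeasurableSet A ∧
      (Measure.pi fun _ => μ) A ≤ ENNReal.ofReal (16 / (n : ℝ) ^ 2) ∧
      ∀ z ∉ A, ∀ k, ∀ f ∈ F k, loss μ f ≤ empLoss z f + penalty z (F k) k f := by
  set ν : Measure (Fin n → Feature d × Bool) := Measure.pi fun _ => μ
  let B : ℕ+ → Set (Fin n → Feature d × Bool) := fun k =>
    {z | ∃ f ∈ F k, empLoss z f + deviation (complexity n (F k) k) (empLoss z f) < loss μ f}
  refine ⟨⋃ k, toMeasurable ν (B k), .iUnion fun k => measurableSet_toMeasurable _ _, ?_, ?_⟩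
  · calc ν (⋃ k, toMeasurable ν (B k)) ≤ ∑' k, ν (toMeasurable ν (B k)) := measure_iUnion_le _
      _ ≤ ∑' k : ℕ+, ENNReal.ofReal (4 / (n : ℝ) ^ 2) * ENNReal.ofReal (1 / (k : ℝ) ^ 2) := by
          refine ENNReal.tsum_le_tsum fun k => ?_
          rw [measure_toMeasurable, ← ENNReal.ofReal_mul (by positivity)]
          refine (measure_exists_deviation_lt_le (hF k) (hne k) hn
            (complexity_nonneg hn _ _)).trans (le_of_eq ?_)
          rw [shatterCoeff_mul_exp_neg_complexity hn (hne k)]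
          congr 1
          rw [mul_pow, div_mul_div_comm, mul_one, mul_one_div]
      _ ≤ ENNReal.ofReal (4 / (n : ℝ) ^ 2) * ENNReal.ofReal 4 := by
          rw [ENNReal.tsum_mul_left]
          gcongr
          exact tsum_ofReal_inv_sq_pnat_le
      _ = _ := by
          rw [← ENNReal.ofReal_mul (by positivity)]
          congr 1
          ring
  · intro z hz k f hf
    by_contra! hlt
    rw [penalty_eq_deviation] at hlt
    exact hz (Set.mem_iUnion.2 ⟨k, subset_toMeasurable _ _ ⟨f, hf, hlt⟩⟩)

/-! ### Measurability and expectations. -/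

/-- The minimizers may depend on the data in a nonmeasurable way, but their empirical loss is this
infimum, whose strict sublevel sets are finite unions over label vectors. -/
lemma aemeasurable_sInf_empLoss {μ : Measure (Feature d × Bool)} [IsProbabilityMeasure μ]
    {F : Set (Classifier d)} (hF : IsRegularClass μ.fst F) (hne : F.Nonempty) :
    AEMeasurable (fun z : Fin n → Feature d × Bool => sInf (empLoss z '' F))
      (Measure.pi fun _ => μ) := by
  set ν : Measure (Fin n → Feature d × Bool) := Measure.pi fun _ => μ
  suffices key : ∀ t, NullMeasurableSet
      ((fun z : Fin n → Feature d × Bool => sInf (empLoss z '' F)) ⁻¹' Set.Iio t) ν from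
    NullMeasurable.aemeasurable (measurable_of_Iio
      (δ := NullMeasurableSpace (Fin n → Feature d × Bool) ν) key)
  intro t
  have : (fun z : Fin n → Feature d × Bool => sInf (empLoss z '' F)) ⁻¹' Set.Iio t
      = ⋃ b : Fin n → Bool, {z : Fin n → Feature d × Bool | b ∈ indexedTrace F fun i => (z i).1}
        ∩ {z | (∑ i, errors z b i) / n < t} := by
    ext z
    have hbdd : BddBelow (empLoss z '' F) := ⟨0, by
      rintro _ ⟨f, -, rfl⟩
      exact empLoss_nonneg z f⟩
    simp only [Set.mem_preimage, Set.mem_Iio, csInf_lt_iff hbdd (hne.image _), Set.mem_iUnion,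
      Set.exists_mem_image]
    constructor
    · rintro ⟨f, hf, h⟩
      exact ⟨fun i => f (z i).1, ⟨f, hf, fun _ => rfl⟩, by rwa [empLoss_eq_errors] at h⟩
    · rintro ⟨b, ⟨f, hf, hb⟩, h⟩
      refine ⟨f, hf, ?_⟩
      rw [empLoss_eq_errors, funext hb]
      exact h
  rw [this]
  refine NullMeasurableSet.iUnion fun b => (hF.nullMeasurableSet_indexedTrace b).inter
    (MeasurableSet.nullMeasurableSet ?_)
  exact measurableSet_lt ((Finset.measurable_sum _ fun i _ =>
    (measurable_pi_apply i).comp (measurable_errors b)).div_const _) measurable_const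

lemma IsEmpiricalMinimizer.sInf_eq {z : Fin n → Feature d × Bool} {F : Set (Classifier d)}
    {f : Classifier d} (h : IsEmpiricalMinimizer z F f) : sInf (empLoss z '' F) = empLoss z f :=
  IsLeast.csInf_eq ⟨⟨f, h.1, rfl⟩, by rintro _ ⟨g, hg, rfl⟩; exact h.2 g hg⟩

section Expectation

variable {Ω : Type*} [MeasurableSpace Ω] {P : Measure Ω} [IsProbabilityMeasure P] {X : Ω → ℝ}

lemma integrable_of_mem_Icc_zero_one (hX : AEMeasurable X P) (h : ∀ ω, X ω ∈ Set.Icc (0 : ℝ) 1) :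
    Integrable X P :=
  Integrable.of_bound hX.aestronglyMeasurable 1 (.of_forall fun ω => by
    rw [Real.norm_of_nonneg (h ω).1]; exact (h ω).2)

lemma integrable_deviation (hX : AEMeasurable X P) (h : ∀ ω, X ω ∈ Set.Icc (0 : ℝ) 1) (a : ℝ) :
    Integrable (fun ω => deviation a (X ω)) P := by
  refine Integrable.of_bound (C := deviation a 1) ?_ (.of_forall fun ω => ?_)
  · unfold deviation
    exact ((((hX.const_mul 2).add_const _).sqrt.const_mul 2).mul_const _).aestronglyMeasurable
  · rw [Real.norm_of_nonneg (deviation_nonneg _ _)]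
    unfold deviation
    gcongr
    exact (h ω).2

lemma integral_deviation_le (hX : AEMeasurable X P) (h : ∀ ω, X ω ∈ Set.Icc (0 : ℝ) 1) {a L : ℝ}
    (ha : 0 ≤ a) (hL : ∫ ω, X ω ∂P ≤ L) :
    ∫ ω, deviation a (X ω) ∂P ≤ 4 * √(L + 2 * a) * √a := by
  have hXint := integrable_of_mem_Icc_zero_one hX h
  have hL0 : 0 ≤ L := (integral_nonneg fun ω => (h ω).1).trans hL
  have hint : Integrable (fun ω => 2 * X ω + 8 * a) P :=
    (hXint.const_mul 2).add (integrable_const _)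
  have hsqrt : Integrable (fun ω => √(2 * X ω + 8 * a)) P := by
    refine Integrable.of_bound (C := √(2 * 1 + 8 * a))
      ((hX.const_mul 2).add_const _).sqrt.aestronglyMeasurable (.of_forall fun ω => ?_)
    rw [Real.norm_of_nonneg (Real.sqrt_nonneg _)]
    gcongr
    exact (h ω).2
  have hjensen : ∫ ω, √(2 * X ω + 8 * a) ∂P ≤ √(∫ ω, (2 * X ω + 8 * a) ∂P) :=
    Real.strictConcaveOn_sqrt.concaveOn.le_map_integral Real.continuous_sqrt.continuousOn
      isClosed_Ici (.of_forall fun ω => by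
        have := (h ω).1
        simp only [Set.mem_Ici]
        positivity) hint hsqrt
  have hval : ∫ ω, (2 * X ω + 8 * a) ∂P = 2 * ∫ ω, X ω ∂P + 8 * a := by
    rw [integral_add (hXint.const_mul 2) (integrable_const _), integral_const_mul]
    simp
  have hbound : ∫ ω, √(2 * X ω + 8 * a) ∂P ≤ 2 * √(L + 2 * a) := by
    -- Here 2L + 8a is enlarged to 4L + 8a, which yields the stated explicit form.
    calc _ ≤ √(2 ^ 2 * (L + 2 * a)) := hjensen.trans (Real.sqrt_le_sqrt (by rw [hval]; linarith))
      _ = _ := by rw [Real.sqrt_mul (by norm_num), Real.sqrt_sq (by norm_num)]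
  unfold deviation
  rw [integral_mul_const, integral_const_mul]
  refine mul_le_mul_of_nonneg_right ?_ (Real.sqrt_nonneg a)
  linarith

end Expectation

end Oracle

end PenalizedClassification

/-! ### The oracle inequality. -/

theorem theorem3p1 {d n : ℕ} (hn : 1 ≤ n)
    -- the law of (X, Y), and the model classes F₁, F₂, …
    (μ : Measure (PenalizedClassification.Feature d × Bool)) [IsProbabilityMeasure μ]
    (F : ℕ+ → Set (PenalizedClassification.Classifier d))
    (hF : ∀ k, PenalizedClassification.IsRegularClass μ.fst (F k))
    -- an i.i.d. sample Z₁, …, Zₙ of pairs with law μ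
    {Ω : Type*} [MeasurableSpace Ω] (P : Measure Ω) [IsProbabilityMeasure P]
    (Z : Fin n → Ω → PenalizedClassification.Feature d × Bool)
    (hZ_meas : ∀ i, Measurable (Z i)) (hZ_indep : iIndepFun Z P) (hZ_law : ∀ i, P.map (Z i) = μ)
    -- empirical loss minimizers in the classes, and the selected index
    (fhat : ℕ+ → Ω → PenalizedClassification.Classifier d)
    (hfhat : ∀ k ω,
      PenalizedClassification.IsEmpiricalMinimizer (fun i => Z i ω) (F k) (fhat k ω))
    (khat : Ω → ℕ+)
    (hkhat : ∀ ω j,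
      PenalizedClassification.empLoss (fun i => Z i ω) (fhat (khat ω) ω)
          + PenalizedClassification.penalty (fun i => Z i ω) (F (khat ω)) (khat ω)
              (fhat (khat ω) ω)
        ≤ PenalizedClassification.empLoss (fun i => Z i ω) (fhat j ω)
          + PenalizedClassification.penalty (fun i => Z i ω) (F j) j (fhat j ω))
    -- the loss of the selected classifier is a random variable
    (hL_meas : AEMeasurable (fun ω => PenalizedClassification.loss μ (fhat (khat ω) ω)) P) :
    -- the expectations exist
    Integrable (fun ω => PenalizedClassification.loss μ (fhat (khat ω) ω)) P ∧
    (∀ k, Integrable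
      (fun ω => PenalizedClassification.penalty (fun i => Z i ω) (F k) k (fhat k ω)) P) ∧
    -- the oracle inequality
    ((∫ ω, PenalizedClassification.loss μ (fhat (khat ω) ω) ∂P)
        - PenalizedClassification.bayesLoss μ
      ≤ (⨅ k : ℕ+, (PenalizedClassification.minLoss μ (F k) - PenalizedClassification.bayesLoss μ
          + ∫ ω, PenalizedClassification.penalty (fun i => Z i ω) (F k) k (fhat k ω) ∂P))
        + 16 / (n : ℝ) ^ 2) ∧
    -- its explicit form
    ((∫ ω, PenalizedClassification.loss μ (fhat (khat ω) ω) ∂P)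
        - PenalizedClassification.bayesLoss μ
      ≤ (⨅ k : ℕ+, (PenalizedClassification.minLoss μ (F k) - PenalizedClassification.bayesLoss μ
          + 4 * √(PenalizedClassification.minLoss μ (F k)
                + 2 / n * (Real.log (PenalizedClassification.shatterCoeff (F k) (2 * n))
                  + 2 * Real.log (n * k)))
            * √(Real.log (PenalizedClassification.shatterCoeff (F k) (2 * n)) / n
                + 2 * (Real.log (n * k) / n))))
        + 16 / (n : ℝ) ^ 2) := by
  have hne : ∀ k, (F k).Nonempty := fun k => by
    obtain ⟨ω⟩ := nonempty_of_isProbabilityMeasure P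
    exact ⟨fhat k ω, (hfhat k ω).1⟩
  have hmp : MeasurePreserving (fun ω i => Z i ω) P (Measure.pi fun _ => μ) :=
    ⟨measurable_pi_iff.2 hZ_meas, by
      rw [(iIndepFun_iff_map_fun_eq_pi_map fun i => (hZ_meas i).aemeasurable).1 hZ_indep]
      simp_rw [hZ_law]⟩
  have hX_meas : ∀ k, AEMeasurable
      (fun ω => PenalizedClassification.empLoss (fun i => Z i ω) (fhat k ω)) P := fun k => by
    have := (PenalizedClassification.aemeasurable_sInf_empLoss (n := n) (hF k)
      (hne k)).comp_quasiMeasurePreserving hmp.quasiMeasurePreserving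
    refine this.congr (.of_forall fun ω => ?_)
    exact (hfhat k ω).sInf_eq
  have hX_mem : ∀ k ω,
      PenalizedClassification.empLoss (fun i => Z i ω) (fhat k ω) ∈ Set.Icc (0 : ℝ) 1 :=
    fun k ω => ⟨PenalizedClassification.empLoss_nonneg _ _,
      PenalizedClassification.empLoss_le_one _ _⟩
  have hX_int := fun k =>
    PenalizedClassification.integrable_of_mem_Icc_zero_one (hX_meas k) (hX_mem k)
  -- The minimizer does at least as well on the sample as each fixed f, whose empirical loss has
  -- mean L(f).
  have hX_le : ∀ k, ∫ ω, PenalizedClassification.empLoss (fun i => Z i ω) (fhat k ω) ∂P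
      ≤ PenalizedClassification.minLoss μ (F k) := fun k => by
    refine le_csInf ((hne k).image _) ?_
    rintro _ ⟨f, hf, rfl⟩
    have hfm := (hF k).measurable f hf
    rw [← PenalizedClassification.integral_empLoss hn hfm, ← hmp.map_eq, integral_map
      hmp.measurable.aemeasurable
      (PenalizedClassification.measurable_empLoss hfm).aestronglyMeasurable]
    refine integral_mono (hX_int k) ?_ fun ω => (hfhat k ω).2 f hf
    exact hmp.integrable_comp_of_integrable
      ((PenalizedClassification.memLp_empLoss hfm 1).integrable le_rfl)
  have hL_int : Integrable (fun ω => PenalizedClassification.loss μ (fhat (khat ω) ω)) P :=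
    PenalizedClassification.integrable_of_mem_Icc_zero_one hL_meas fun ω =>
      ⟨PenalizedClassification.loss_nonneg _ _, PenalizedClassification.loss_le_one _ _⟩
  have hpen_int : ∀ k, Integrable
      (fun ω => PenalizedClassification.penalty (fun i => Z i ω) (F k) k (fhat k ω)) P :=
    fun k => by
      simp_rw [PenalizedClassification.penalty_eq_deviation]
      exact PenalizedClassification.integrable_deviation (hX_meas k) (hX_mem k) _
  obtain ⟨A, hA, hA_le, hA_loss⟩ :=
    PenalizedClassification.exists_measurableSet_deviation (μ := μ) hn hF hne
  set A' : Set Ω := (fun ω i => Z i ω) ⁻¹' A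
  have hA' : MeasurableSet A' := hmp.measurable hA
  have hA'_le : P.real A' ≤ 16 / (n : ℝ) ^ 2 := by
    refine ENNReal.toReal_le_of_le_ofReal (by positivity) ?_
    rwa [hmp.measure_preimage hA.nullMeasurableSet]
  have hone_int : Integrable (A'.indicator (1 : Ω → ℝ)) P :=
    (integrable_const (1 : ℝ)).indicator hA'
  have hmain : ∀ k, ∫ ω, PenalizedClassification.loss μ (fhat (khat ω) ω) ∂P
      ≤ PenalizedClassification.minLoss μ (F k)
        + ∫ ω, PenalizedClassification.penalty (fun i => Z i ω) (F k) k (fhat k ω) ∂P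
        + 16 / (n : ℝ) ^ 2 := fun k => by
    have hsum_int : Integrable (fun ω => PenalizedClassification.empLoss (fun i => Z i ω) (fhat k ω)
        + PenalizedClassification.penalty (fun i => Z i ω) (F k) k (fhat k ω)) P :=
      (hX_int k).add (hpen_int k)
    have hle : ∫ ω, PenalizedClassification.loss μ (fhat (khat ω) ω) ∂P
        ≤ ∫ ω, (PenalizedClassification.empLoss (fun i => Z i ω) (fhat k ω)
          + PenalizedClassification.penalty (fun i => Z i ω) (F k) k (fhat k ω)
          + A'.indicator 1 ω) ∂P := by
      -- On the exceptional event the indicator alone dominates the loss; elsewhere the deviation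
      -- bound for the class `khat ω` is followed by the minimality of `khat ω`.
      refine integral_mono hL_int (hsum_int.add hone_int) fun ω => ?_
      by_cases hω : ω ∈ A'
      · have h1 := PenalizedClassification.loss_le_one μ (fhat (khat ω) ω)
        have h2 := (hX_mem k ω).1
        have h3 : 0 ≤ PenalizedClassification.penalty (fun i => Z i ω) (F k) k (fhat k ω) := by
          rw [PenalizedClassification.penalty_eq_deviation]
          exact PenalizedClassification.deviation_nonneg _ _
        simp only [Set.indicator_of_mem hω, Pi.one_apply]
        linarith
      · simp only [Set.indicator_of_notMem hω, add_zero]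
        exact (hA_loss _ hω (khat ω) _ (hfhat (khat ω) ω).1).trans (hkhat ω k)
    rw [integral_add hsum_int hone_int, integral_add (hX_int k) (hpen_int k),
      integral_indicator_one hA'] at hle
    linarith [hX_le k]
  refine ⟨hL_int, hpen_int, ?_, ?_⟩
  -- The Bayes loss cancels from both sides, so no property of it is needed.
  · rw [← sub_le_iff_le_add]
    exact le_ciInf fun k => by linarith [hmain k]
  · rw [← sub_le_iff_le_add]
    refine le_ciInf fun k => ?_
    have hdev := PenalizedClassification.integral_deviation_le (hX_meas k) (hX_mem k)
      (PenalizedClassification.complexity_nonneg hn (F k) k) (hX_le k)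
    simp_rw [← PenalizedClassification.penalty_eq_deviation] at hdev
    have e1 : 2 / n * (Real.log (PenalizedClassification.shatterCoeff (F k) (2 * n))
        + 2 * Real.log (n * k)) = 2 * PenalizedClassification.complexity n (F k) k := by
      unfold PenalizedClassification.complexity; ring
    have e2 : Real.log (PenalizedClassification.shatterCoeff (F k) (2 * n)) / n
        + 2 * (Real.log (n * k) / n) = PenalizedClassification.complexity n (F k) k := by
      unfold PenalizedClassification.complexity; ring
    rw [e1, e2]
    linarith [hmain k]
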